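/- Let $R\ge 0$ be an integer, let $J$ be a real number, and let $t_0>0$. There is a constant $C$, depending only on $R$, $J$ and $t_0$, such that the following holds for every $N$ and $q$. Consider an open chain of $N$ sites with Hilbert space $(\mathbb C^q)^{\otimes N}$. Let $\|\cdot\|$ be the operator norm, and for a super-operator $\mathcal T$ (a linear map on operators) let $\|\mathcal T\|=\sup_{X\ne 0}\|\mathcal T\cdot X\|/\|X\|$. For each time $\tau$ let $$\mathcal L^\dagger_H(\tau)=\sum_{i=1}^N\mathcal L^\dagger_{H_i}(\tau),\qquad \mathcal L^\dagger_D(\tau)=\Gamma\sum_{k=1}^N\mathcal L^\dagger_{D,k}(\tau),\qquad \Gamma\ge 0,$$ where all the super-operators $\mathcal L^\dagger_{H_i}(\tau)$, $\mathcal L^\dagger_{D,k}(\tau)$ depend continuously on $\tau$ and, for all $\tau$: - $\mathcal L^\dagger_{H_i}(\tau)\cdot X=i[H_i(\tau),X]$, where $H_i(\tau)$ is Hermitian and acts only on the sites at distance at most $R$ from site $i$, and $\|\mathcal L^\dagger_{H_i}(\tau)\|\le J$; - $\mathcal L^\dagger_{D,k}(\tau)\cdot X=\sum_j\frac12\bigl(2L_{j}^\dagger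 XL_{j}-XL_{j}^\dagger L_{j}-L_{j}^\dagger L_{j}X\bigr)$ for finitely many Lindblad operators $L_j$ (depending on $k$ and $\tau$) that act only on site $k$, and $\|\mathcal L^\dagger_{D,k}(\tau)\|\le 1$. Let $$\mathcal V_1^\dagger(t,0)=\mathcal T_{\to}\,e^{\int_0^t(\mathcal L^\dagger_H(\tau)+\mathcal L^\dagger_D(\tau))\,d\tau},\qquad \mathcal V_0^\dagger(t,0)=\mathcal T_{\to}\,e^{\int_0^t\mathcal L^\dagger_H(\tau)\,d\tau}$$ be the dissipative and the unitary adjoint propagators, where $\mathcal T_\to$ orders products so that times increase from left to right. Then, for every operator $B$ (in particular, every observable) that acts only on a single site of the chain, and for all $t\ge t_0$, $$\bigl\|\mathcal V_1^\dagger(t,0)\cdot B-\mathcal V_0^\dagger(t,0)\cdot B\bigr\|\le \Gamma\, C\,t^2\,\|B\|.$$ -/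

import Mathlib

open scoped Matrix.Norms.L2Operator

noncomputable section

namespace SpinChain

/-- Operators on the Hilbert space `(ℂ^q)^{⊗ N}` of an open chain of `N` sites with `q` levels per
site, written as matrices in the product basis `|σ₁ … σ_N⟩`. They carry the operator norm induced
by the Hilbert space norm (the `L2Operator` scope). -/
abbrev Op (N q : ℕ) : Type := Matrix (Fin N → Fin q) (Fin N → Fin q) ℂ

/-- Super-operators: linear maps on operators, with the norm `sup ‖T X‖ / ‖X‖`
induced by the operator norm. Multiplication is composition. -/
abbrev SuperOp (N q : ℕ) : Type := Op N q →L[ℂ] Op N q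

/-- `A` acts only on the sites in `S`, that is, `A = a ⊗ 1` where `a` is an operator on the
sites in `S` and `1` is the identity on all the other sites. -/
def SupportedOn {N q : ℕ} (S : Finset (Fin N)) (A : Op N q) : Prop :=
  ∃ a : Matrix (S → Fin q) (S → Fin q) ℂ, ∀ σ τ : Fin N → Fin q,
    A σ τ = if ∀ k, k ∉ S → σ k = τ k then a (fun k => σ k) (fun k => τ k) else 0

/-- The sites of the chain at distance at most `R` from the site `i`. -/
def nbhd {N : ℕ} (R : ℕ) (i : Fin N) : Finset (Fin N) :=
  Finset.univ.filter fun j => (j : ℕ) ≤ i + R ∧ (i : ℕ) ≤ j + R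

/-- Left multiplication `X ↦ A X`. -/
def mulLeft {N q : ℕ} (A : Op N q) : SuperOp N q := ContinuousLinearMap.mul ℂ (Op N q) A

/-- Right multiplication `X ↦ X A`. -/
def mulRight {N q : ℕ} (A : Op N q) : SuperOp N q := (ContinuousLinearMap.mul ℂ (Op N q)).flip A

/-- The adjoint Liouvillian `X ↦ i [H, X]` of a Hamiltonian `H`. -/
def hamiltonianPart {N q : ℕ} (H : Op N q) : SuperOp N q :=
  Complex.I • (mulLeft H - mulRight H)

/-- The adjoint dissipator `X ↦ ∑ⱼ (1/2) (2 Lⱼ† X Lⱼ - X Lⱼ† Lⱼ - Lⱼ† Lⱼ X)` of a finite family of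
Lindblad operators. -/
def dissipator {N q m : ℕ} (L : Fin m → Op N q) : SuperOp N q :=
  ∑ j, (1 / 2 : ℂ) • ((2 : ℂ) • (mulLeft (L j).conjTranspose * mulRight (L j))
    - mulRight ((L j).conjTranspose * L j) - mulLeft ((L j).conjTranspose * L j))

/-- `T` is the adjoint Liouvillian of a Hamiltonian term that acts only on the sites in `S`. -/
def IsLocalHamiltonianLiouvillian {N q : ℕ} (S : Finset (Fin N)) (T : SuperOp N q) : Prop :=
  ∃ H : Op N q, H.IsHermitian ∧ SupportedOn S H ∧ T = hamiltonianPart H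

/-- `T` is an adjoint dissipator acting on the single site `k`: its Lindblad operators act only
on that site. -/
def IsSiteDissipator {N q : ℕ} (k : Fin N) (T : SuperOp N q) : Prop :=
  ∃ (m : ℕ) (L : Fin m → Op N q), (∀ j, SupportedOn {k} (L j)) ∧ T = dissipator L

/-- The terms of the Dyson series: `dysonTerm L s n t` is the integral of
`L τ₁ * L τ₂ * ⋯ * L τₙ` over `s ≤ τ₁ ≤ τ₂ ≤ ⋯ ≤ τₙ ≤ t`. -/
def dysonTerm {𝔸 : Type*} [NormedRing 𝔸] [NormedSpace ℝ 𝔸] (L : ℝ → 𝔸) (s : ℝ) : ℕ → ℝ → 𝔸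
  | 0, _ => 1
  | n + 1, t => ∫ τ in s..t, dysonTerm L s n τ * L τ

/-- The time-ordered exponential of `∫_s^t L τ dτ`, in which the times increase from left to
right. -/
def timeOrderedExp {𝔸 : Type*} [NormedRing 𝔸] [NormedSpace ℝ 𝔸] (L : ℝ → 𝔸) (t s : ℝ) : 𝔸 :=
  ∑' n, dysonTerm L s n t

end SpinChain

end

namespace SpinChain

open Filter Topology Set

/-! ### The Dyson series -/

section Dyson

variable {𝔸 : Type*} [NormedRing 𝔸] [NormedAlgebra ℝ 𝔸]

/-! Write `V s` for the dissipative propagator from 0 to `s`, `W s` for the inverse of the unitary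
one, and `U` for the unitary propagator up to `t`. The curve `s ↦ V s (W s (U B))` joins `U B` at `s
= 0` to `V t B` at `s = t`, and by Duhamel its derivative is `V s (D s (W s (U B)))`. Since `V s` is
a contraction, it suffices to bound `D s` on the unitarily evolved operator `W s (U B)` by `Γ ‖B‖`
times an affine function of `t`, uniformly in `N` and `q`; integration over `s` supplies the other
factor `t`.

Contractivity (`norm_timeOrderedExp_le_one`) holds because Hamiltonian and Lindblad generators have
nonpositive logarithmic norm: to first order in `h`, `1 + h • A` is a Kraus map that is unital up to
`O(h ^ 2)`. Norms need not be differentiable, so growth is measured by Dini derivatives.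

The bound on `D s` is a light-cone count (`sum_norm_fluctuation_le`). The dissipator at `k`
annihilates whatever acts trivially near `k`, so it sees only `fluctuation (nbhd R k)` of the
evolved operator. These fluctuations obey a closed system of differential inequalities; Grönwall
with weights `2 ^ siteDist` makes them decay exponentially outside a cone of radius linear in time.
Inside the cone the trivial bound `2 ‖B‖` suffices, so their sum over the chain is affine in time.
-/

theorem continuous_dysonTerm {L : ℝ → 𝔸} (hL : Continuous L) (s : ℝ) (n : ℕ) :
    Continuous (dysonTerm L s n) := by
  induction n with
  | zero => exact continuous_const
  | succ n ih =>
    exact intervalIntegral.continuous_primitive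
      (fun a b => (ih.mul hL).intervalIntegrable a b) s

theorem timeOrderedExp_self (L : ℝ → 𝔸) (s : ℝ) : timeOrderedExp L s s = 1 := by
  have h : ∀ n ≠ 0, dysonTerm L s n s = 0 := by
    intro n hn
    obtain ⟨k, rfl⟩ := Nat.exists_eq_succ_of_ne_zero hn
    exact intervalIntegral.integral_same
  rw [timeOrderedExp, tsum_eq_single 0 h]
  rfl

/-- The usual exponential-series bound. The factor `‖1‖` stays because the algebra may be trivial,
in which case the norm of the unit is 0. -/
theorem norm_dysonTerm_le {L : ℝ → 𝔸} (hL : Continuous L) {M T : ℝ} (hM : 0 ≤ M)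
    (hLM : ∀ τ ∈ Icc (-T) T, ‖L τ‖ ≤ M) (n : ℕ) :
    ∀ t ∈ Icc (-T) T, ‖dysonTerm L 0 n t‖ ≤ ‖(1 : 𝔸)‖ * ((M * |t|) ^ n / n.factorial) := by
  induction n with
  | zero => intro t _; simp [dysonTerm]
  | succ n ih =>
    intro t ht
    have hT : (0 : ℝ) ∈ Icc (-T) T := by
      constructor <;> linarith [ht.1, ht.2]
    have hsub : Set.uIoc 0 t ⊆ Icc (-T) T :=
      Set.uIoc_subset_uIcc.trans (Set.uIcc_subset_Icc hT ht)
    have hcont := (continuous_dysonTerm hL 0 n).mul hL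
    calc ‖dysonTerm L 0 (n + 1) t‖
        ≤ ∫ τ in Set.uIoc 0 t, ‖dysonTerm L 0 n τ * L τ‖ :=
          intervalIntegral.norm_integral_le_integral_norm_uIoc
      _ ≤ ∫ τ in Set.uIoc 0 t, ‖(1 : 𝔸)‖ * (M ^ (n + 1) / n.factorial) * |τ - 0| ^ n := by
          refine MeasureTheory.setIntegral_mono_on ?_ ?_ measurableSet_uIoc ?_
          · exact (intervalIntegrable_iff.mp (hcont.norm.intervalIntegrable 0 t))
          · refine intervalIntegrable_iff.mp (Continuous.intervalIntegrable ?_ 0 t)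
            fun_prop
          · intro τ hτ
            calc ‖dysonTerm L 0 n τ * L τ‖ ≤ ‖dysonTerm L 0 n τ‖ * ‖L τ‖ := norm_mul_le _ _
              _ ≤ (‖(1 : 𝔸)‖ * ((M * |τ|) ^ n / n.factorial)) * M := by
                  gcongr
                  · exact ih τ (hsub hτ)
                  · exact hLM τ (hsub hτ)
              _ = _ := by rw [sub_zero]; ring
      _ = ‖(1 : 𝔸)‖ * ((M * |t|) ^ (n + 1) / (n + 1).factorial) := by
          rw [MeasureTheory.integral_const_mul, integral_pow_abs_sub_uIoc, sub_zero,
            Nat.factorial_succ]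
          push_cast
          rw [mul_pow]
          field_simp

variable [CompleteSpace 𝔸]

theorem hasDerivAt_dysonTerm_succ {L : ℝ → 𝔸} (hL : Continuous L) (s : ℝ) (n : ℕ) (t : ℝ) :
    HasDerivAt (dysonTerm L s (n + 1)) (dysonTerm L s n t * L t) t :=
  intervalIntegral.integral_hasDerivAt_right
    (((continuous_dysonTerm hL s n).mul hL).intervalIntegrable _ _)
    (((continuous_dysonTerm hL s n).mul hL).stronglyMeasurableAtFilter _ _)
    ((continuous_dysonTerm hL s n).mul hL).continuousAt

/-- Termwise differentiation on a bounded interval around `t`, where the exponential series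
dominates. The factor `L t` is on the right because times increase from left to right. -/
theorem hasDerivAt_timeOrderedExp {L : ℝ → 𝔸} (hL : Continuous L) (t : ℝ) :
    HasDerivAt (fun t => timeOrderedExp L t 0) (timeOrderedExp L t 0 * L t) t := by
  set T : ℝ := |t| + 1 with hT
  have hT0 : 0 < T := by positivity
  obtain ⟨M, hM⟩ := (isCompact_Icc (a := -T) (b := T)).exists_bound_of_continuousOn hL.continuousOn
  have hM0 : 0 ≤ M := (norm_nonneg _).trans (hM 0 ⟨by linarith, hT0.le⟩)
  have hterm : ∀ n, ∀ y ∈ Ioo (-T) T,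
      ‖dysonTerm L 0 n y‖ ≤ ‖(1 : 𝔸)‖ * ((M * T) ^ n / n.factorial) := by
    intro n y hy
    refine (norm_dysonTerm_le hL hM0 hM n y (Ioo_subset_Icc_self hy)).trans ?_
    have : |y| ≤ T := abs_le.mpr ⟨hy.1.le, hy.2.le⟩
    gcongr
  have hsum : Summable fun n : ℕ => ‖(1 : 𝔸)‖ * ((M * T) ^ n / n.factorial) :=
    (Real.summable_pow_div_factorial _).mul_left _
  set g' : ℕ → ℝ → 𝔸 := fun n y => n.casesOn 0 (fun k => dysonTerm L 0 k y * L y) with hg'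
  set u : ℕ → ℝ := fun n => n.casesOn 0
    (fun k => ‖(1 : 𝔸)‖ * ((M * T) ^ k / k.factorial) * M) with hu
  have husum : Summable u := (summable_nat_add_iff 1).mp (hsum.mul_right M)
  have ht : t ∈ Ioo (-T) T := abs_lt.mp (by linarith)
  have hts : Summable fun n => dysonTerm L 0 n t :=
    Summable.of_norm_bounded hsum fun n => hterm n t ht
  have key := hasDerivAt_tsum_of_isPreconnected (g := fun n y => dysonTerm L 0 n y) (g' := g')
    husum isOpen_Ioo isPreconnected_Ioo
    (fun n y hy => by
      cases n with
      | zero => exact hasDerivAt_const y 1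
      | succ k => exact hasDerivAt_dysonTerm_succ hL 0 k y)
    (fun n y hy => by
      cases n with
      | zero => simp [hg', hu]
      | succ k =>
        exact (norm_mul_le _ _).trans (mul_le_mul (hterm k y hy)
          (hM y (Ioo_subset_Icc_self hy)) (norm_nonneg _) (by positivity)))
    ht hts ht
  have hval : ∑' n, g' n t = timeOrderedExp L t 0 * L t := by
    have h1 : HasSum (fun k => g' (k + 1) t) (timeOrderedExp L t 0 * L t) :=
      hts.hasSum.mul_right (L t)
    have h2 := (hasSum_nat_add_iff (f := fun n => g' n t) 1).mp h1
    simpa [hg'] using h2.tsum_eq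
  rw [hval] at key
  exact key

/-- The left linear differential equation `W' = - L W` has a solution which starts at `1`. -/
theorem exists_hasDerivAt_neg_mul {L : ℝ → 𝔸} (hL : Continuous L) :
    ∃ W : ℝ → 𝔸, W 0 = 1 ∧ ∀ t, HasDerivAt W (-(L t * W t)) t := by
  -- In the opposite algebra the equation becomes `W' = W * (-L)`, which a time-ordered exponential
  -- solves.
  set L' : ℝ → 𝔸ᵐᵒᵖ := fun t => MulOpposite.op (-L t) with hL'
  have hc : Continuous L' := MulOpposite.continuous_op.comp hL.neg
  refine ⟨fun t => MulOpposite.unop (timeOrderedExp L' t 0), ?_, fun t => ?_⟩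
  · simp [timeOrderedExp_self]
  · have h := hasDerivAt_timeOrderedExp hc t
    have h2 := ((MulOpposite.opContinuousLinearEquiv ℝ (M := 𝔸)).symm :
      𝔸ᵐᵒᵖ →L[ℝ] 𝔸).hasFDerivAt.comp_hasDerivAt t h
    exact h2.congr_deriv (by simp [hL'])

theorem eq_of_forall_hasDerivAt_zero {E : Type*} [NormedAddCommGroup E] [NormedSpace ℝ E]
    {f : ℝ → E} (hf : ∀ t, HasDerivAt f 0 t) (s t : ℝ) : f s = f t :=
  is_const_of_deriv_eq_zero (fun t => (hf t).differentiableAt) (fun t => (hf t).deriv) s t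

/-- Duhamel's formula in differential form. -/
theorem hasDerivAt_mul_of_propagators {𝔸 : Type*} [NormedRing 𝔸] [NormedAlgebra ℝ 𝔸]
    {V W : ℝ → 𝔸} {A D : 𝔸} {s : ℝ} (hV : HasDerivAt V (V s * (A + D)) s)
    (hW : HasDerivAt W (-(A * W s)) s) : HasDerivAt (fun s => V s * W s) (V s * (D * W s)) s :=
  (hV.fun_mul hW).congr_deriv (by noncomm_ring)

theorem timeOrderedExp_mul_eq_one {L W : ℝ → 𝔸} (hL : Continuous L) (hW0 : W 0 = 1)
    (hW : ∀ t, HasDerivAt W (-(L t * W t)) t) (t : ℝ) : timeOrderedExp L t 0 * W t = 1 := by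
  have h : ∀ t, HasDerivAt (fun t => timeOrderedExp L t 0 * W t) 0 t := fun t => by
    exact ((hasDerivAt_timeOrderedExp hL t).fun_mul (hW t)).congr_deriv (by noncomm_ring)
  rw [eq_of_forall_hasDerivAt_zero h t 0, timeOrderedExp_self, hW0, one_mul]

end Dyson

/-! ### Dissipative elements and growth of norms -/

section Dissipative

/-- An element of a normed algebra is dissipative if its logarithmic norm is nonpositive. -/
def Dissipative {𝔸 : Type*} [NormedRing 𝔸] [NormedAlgebra ℝ 𝔸] (A : 𝔸) : Prop :=
  ∀ ε > 0, ∀ᶠ h : ℝ in 𝓝[>] 0, ‖1 + h • A‖ ≤ 1 + h * ε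

/-- The upper right Dini derivative of `f` at `x` is at most `c`. -/
def DiniLE (f : ℝ → ℝ) (x c : ℝ) : Prop :=
  ∀ r > c, ∀ᶠ z in 𝓝[>] x, slope f x z < r

variable {𝔸 : Type*} [NormedRing 𝔸] [NormedAlgebra ℝ 𝔸]

theorem Dissipative.of_sq_bound {A : 𝔸} (c : ℝ)
    (h : ∀ h > 0, ‖1 + h • A‖ ≤ 1 + h ^ 2 * c) : Dissipative A := by
  intro ε hε
  have h1 : Tendsto (fun h : ℝ => h * c) (𝓝[>] 0) (𝓝 0) := by
    have : Tendsto (fun h : ℝ => h * c) (𝓝 0) (𝓝 (0 * c)) := (continuous_mul_const c).tendsto 0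
    rw [zero_mul] at this
    exact this.mono_left nhdsWithin_le_nhds
  filter_upwards [h1.eventually_lt_const hε, self_mem_nhdsWithin] with t ht ht0
  refine (h t ht0).trans ?_
  have := mul_le_mul_of_nonneg_left ht.le (le_of_lt (mem_Ioi.mp ht0))
  nlinarith

theorem dissipative_zero (h1 : ‖(1 : 𝔸)‖ ≤ 1) : Dissipative (0 : 𝔸) :=
  Dissipative.of_sq_bound 0 fun h _ => by simpa using h1

theorem eventually_const_mul_nhdsGT_zero {P : ℝ → Prop} (h : ∀ᶠ t in 𝓝[>] (0 : ℝ), P t) {c : ℝ}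
    (hc : 0 < c) : ∀ᶠ t in 𝓝[>] (0 : ℝ), P (c * t) := by
  have : Tendsto (fun t : ℝ => c * t) (𝓝[>] 0) (𝓝[>] 0) := by
    refine tendsto_nhdsWithin_iff.mpr ⟨?_, ?_⟩
    · have : Tendsto (fun t : ℝ => c * t) (𝓝 0) (𝓝 (c * 0)) := (continuous_const_mul c).tendsto 0
      rw [mul_zero] at this
      exact this.mono_left nhdsWithin_le_nhds
    · filter_upwards [self_mem_nhdsWithin] with t ht using mul_pos hc ht
  exact this.eventually h

/-- Convexity of the norm: `1 + h • (A + B)` is the midpoint of `1 + (2 * h) • A` and `1 + (2 * h) •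
B`. -/
theorem Dissipative.add {A B : 𝔸} (hA : Dissipative A) (hB : Dissipative B) :
    Dissipative (A + B) := by
  intro ε hε
  filter_upwards [eventually_const_mul_nhdsGT_zero (hA (ε / 2) (by positivity)) two_pos,
    eventually_const_mul_nhdsGT_zero (hB (ε / 2) (by positivity)) two_pos] with h h1 h2
  have e : (1 : 𝔸) + h • (A + B)
      = (1 / 2 : ℝ) • ((1 + (2 * h) • A) + (1 + (2 * h) • B)) := by
    module
  rw [e, norm_smul]
  have := norm_add_le (1 + (2 * h) • A) (1 + (2 * h) • B)
  rw [Real.norm_of_nonneg (by norm_num)]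
  linarith

theorem Dissipative.smul {A : 𝔸} (hA : Dissipative A) {c : ℝ} (hc : 0 ≤ c)
    (h1 : ‖(1 : 𝔸)‖ ≤ 1) : Dissipative (c • A) := by
  rcases hc.eq_or_lt with rfl | hc
  · simpa using dissipative_zero h1
  intro ε hε
  filter_upwards [eventually_const_mul_nhdsGT_zero (hA (ε / c) (by positivity)) hc] with h hh
  rw [smul_smul, mul_comm h c]
  refine hh.trans (le_of_eq ?_)
  field_simp

theorem Dissipative.sum {ι : Type*} {A : ι → 𝔸} (s : Finset ι) (hA : ∀ i ∈ s, Dissipative (A i))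
    (h1 : ‖(1 : 𝔸)‖ ≤ 1) : Dissipative (∑ i ∈ s, A i) :=
  Finset.sum_induction A Dissipative (fun _ _ => Dissipative.add) (dissipative_zero h1) hA

theorem DiniLE.mono {f : ℝ → ℝ} {x c d : ℝ} (h : DiniLE f x c) (hcd : c ≤ d) : DiniLE f x d :=
  fun r hr => h r (hcd.trans_lt hr)

theorem diniLE_const (a x : ℝ) : DiniLE (fun _ => a) x 0 := by
  intro r hr
  filter_upwards with z
  simpa [slope] using hr

theorem DiniLE.add {f g : ℝ → ℝ} {x c d : ℝ} (hf : DiniLE f x c) (hg : DiniLE g x d) :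
    DiniLE (fun y => f y + g y) x (c + d) := by
  intro r hr
  filter_upwards [hf (c + (r - (c + d)) / 2) (by linarith),
    hg (d + (r - (c + d)) / 2) (by linarith)] with z h1 h2
  have : slope (fun y => f y + g y) x z = slope f x z + slope g x z := by
    simp only [slope_def_field]; ring
  linarith

theorem DiniLE.const_mul {f : ℝ → ℝ} {x c a : ℝ} (hf : DiniLE f x c) (ha : 0 < a) :
    DiniLE (fun y => a * f y) x (a * c) := by
  intro r hr
  filter_upwards [hf (r / a) ((lt_div_iff₀' ha).mpr hr)] with z h1
  have : slope (fun y => a * f y) x z = a * slope f x z := by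
    simp only [slope_def_field]; ring
  rw [this]
  exact (lt_div_iff₀' ha).mp h1

theorem DiniLE.sum {ι : Type*} (s : Finset ι) {f : ι → ℝ → ℝ} {c : ι → ℝ} {x : ℝ}
    (hf : ∀ i ∈ s, DiniLE (f i) x (c i)) :
    DiniLE (fun y => ∑ i ∈ s, f i y) x (∑ i ∈ s, c i) := by
  classical
  induction s using Finset.induction_on with
  | empty => simpa using diniLE_const 0 x
  | insert i s hi ih =>
    simp only [Finset.sum_insert hi]
    exact (hf i (by simp)).add (ih fun j hj => hf j (by simp [hj]))

/-- The norm of a curve `y` grows at most as fast as that of its tangent line. -/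
theorem diniLE_norm_of_hasDerivAt {E : Type*} [NormedAddCommGroup E] [NormedSpace ℝ E]
    {y : ℝ → E} {y' : E} {x c : ℝ} (hy : HasDerivAt y y' x)
    (h : ∀ ε > 0, ∀ᶠ t : ℝ in 𝓝[>] 0, ‖y x + t • y'‖ ≤ ‖y x‖ + t * (c + ε)) :
    DiniLE (fun z => ‖y z‖) x c := by
  intro r hr
  -- One `ε` pays for the tangent line, one for the remainder of the derivative, and the third keeps
  -- the inequality strict.
  set ε := (r - c) / 3 with hε
  have hε0 : 0 < ε := by rw [hε]; linarith
  have hsub : Tendsto (fun z : ℝ => z - x) (𝓝[>] x) (𝓝[>] 0) := by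
    refine tendsto_nhdsWithin_iff.mpr ⟨?_, ?_⟩
    · have : Tendsto (fun z : ℝ => z - x) (𝓝 x) (𝓝 (x - x)) := (continuous_sub_right x).tendsto x
      rw [sub_self] at this
      exact this.mono_left nhdsWithin_le_nhds
    · filter_upwards [self_mem_nhdsWithin] with z hz using sub_pos.mpr (mem_Ioi.mp hz)
  have ho := (hasDerivAt_iff_isLittleO.mp hy).def hε0
  filter_upwards [hsub.eventually (h ε hε0), ho.filter_mono nhdsWithin_le_nhds,
    self_mem_nhdsWithin] with z h1 h2 hz
  have hz' : 0 < z - x := sub_pos.mpr (mem_Ioi.mp hz)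
  rw [Real.norm_of_nonneg hz'.le] at h2
  have h3 : ‖y z‖ ≤ ‖y x + (z - x) • y'‖ + ‖y z - y x - (z - x) • y'‖ := by
    refine le_trans (le_of_eq ?_) (norm_add_le _ _)
    congr 1
    abel
  rw [slope_def_field, div_lt_iff₀ hz']
  have : r = c + 3 * ε := by rw [hε]; ring
  rw [this]
  nlinarith

theorem DiniLE.le_of_nonpos {f : ℝ → ℝ} {T : ℝ} (hf : ContinuousOn f (Icc 0 T))
    (h : ∀ x ∈ Ico 0 T, DiniLE f x 0) : ∀ x ∈ Icc 0 T, f x ≤ f 0 :=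
  image_le_of_liminf_slope_right_le_deriv_boundary (B := fun _ => f 0) (B' := fun _ => 0) hf le_rfl
    continuousOn_const (fun x _ => hasDerivWithinAt_const x _ _)
    (fun x hx r hr => (h x hx r hr).frequently)

theorem DiniLE.le_exp {f : ℝ → ℝ} {T K : ℝ} (hf : ContinuousOn f (Icc 0 T))
    (h : ∀ x ∈ Ico 0 T, DiniLE f x (K * f x)) : ∀ x ∈ Icc 0 T, f x ≤ f 0 * Real.exp (K * x) := by
  intro x hx
  have := le_gronwallBound_of_liminf_deriv_right_le (f := f) (f' := fun x => K * f x) (δ := f 0)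
    (K := K) (ε := 0) hf (fun x hx r hr => by
      refine ((h x hx r hr).mono fun z hz => ?_).frequently
      rwa [slope_def_field, div_eq_inv_mul] at hz) le_rfl (fun x _ => by simp) x hx
  simpa [gronwallBound_ε0] using this

/-- To first order `V` moves to `V * (1 + h • L x)`, whose norm exceeds `‖V‖` by at most `h * ε`; so
`‖V‖` has nonpositive Dini derivative. -/
theorem norm_timeOrderedExp_le_one [CompleteSpace 𝔸] {L : ℝ → 𝔸} (hL : Continuous L)
    (h1 : ‖(1 : 𝔸)‖ ≤ 1) (hd : ∀ t, Dissipative (L t)) {t : ℝ} (ht : 0 ≤ t) :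
    ‖timeOrderedExp L t 0‖ ≤ 1 := by
  have hder := hasDerivAt_timeOrderedExp hL
  have hcont : Continuous fun t => timeOrderedExp L t 0 :=
    continuous_iff_continuousAt.mpr fun t => (hder t).continuousAt
  have := DiniLE.le_of_nonpos (f := fun t => ‖timeOrderedExp L t 0‖) (T := t)
    hcont.norm.continuousOn (fun x _ => by
      refine diniLE_norm_of_hasDerivAt (hder x) fun ε hε => ?_
      set V := timeOrderedExp L x 0
      filter_upwards [hd x (ε / (‖V‖ + 1)) (by positivity), self_mem_nhdsWithin] with h hh hh0
      have hpos : 0 < h := hh0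
      have e : V + h • (V * L x) = V * (1 + h • L x) := by
        rw [mul_add, mul_one, mul_smul_comm]
      rw [e]
      refine (norm_mul_le _ _).trans ((mul_le_mul_of_nonneg_left hh (norm_nonneg _)).trans ?_)
      have : ‖V‖ * (ε / (‖V‖ + 1)) ≤ ε := by
        rw [← mul_div_assoc, div_le_iff₀ (by positivity)]
        nlinarith [norm_nonneg V]
      nlinarith) t ⟨ht, le_rfl⟩
  refine this.trans ?_
  simpa [timeOrderedExp_self] using h1

end Dissipative

/-! ### Norm bounds for maps in Kraus form -/

section Kraus

/-- Test against unit vectors: Cauchy–Schwarz and the arithmetic-geometric mean inequality reduce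
the form to `∑ i, ‖K i x‖ ^ 2`, the quadratic form of `∑ i, star (K i) * K i`. -/
theorem norm_sum_adjoint_mul_mul_le {E ι : Type*} [NormedAddCommGroup E] [InnerProductSpace ℂ E]
    [CompleteSpace E] [Fintype ι] (K : ι → E →L[ℂ] E) (X : E →L[ℂ] E) :
    ‖∑ i, star (K i) * X * K i‖ ≤ ‖∑ i, star (K i) * K i‖ * ‖X‖ := by
  set c := ‖∑ i, star (K i) * K i‖ with hc
  have hsq : ∀ x : E, ‖x‖ = 1 → ∑ i, ‖K i x‖ ^ 2 ≤ c := by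
    intro x hx
    calc ∑ i, ‖K i x‖ ^ 2 = RCLike.re (inner ℂ ((∑ i, star (K i) * K i) x) x) := by
          simp only [sum_apply, sum_inner, map_sum,
            mul_apply_eq_comp, ContinuousLinearMap.star_eq_adjoint,
            ContinuousLinearMap.adjoint_inner_left, inner_self_eq_norm_sq]
      _ ≤ ‖(∑ i, star (K i) * K i) x‖ * ‖x‖ := re_inner_le_norm _ _
      _ ≤ c * ‖x‖ * ‖x‖ := by gcongr; exact ContinuousLinearMap.le_opNorm _ _
      _ = c := by rw [hx, mul_one, mul_one]
  refine ContinuousLinearMap.opNorm_le_of_re_inner_le (by positivity) fun x y hx hy => ?_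
  calc RCLike.re (inner ℂ ((∑ i, star (K i) * X * K i) x) y)
      = ∑ i, RCLike.re (inner ℂ (X (K i x)) (K i y)) := by
        simp only [sum_apply, sum_inner, map_sum,
          mul_apply_eq_comp, ContinuousLinearMap.star_eq_adjoint,
          ContinuousLinearMap.adjoint_inner_left]
    _ ≤ ∑ i, ‖X‖ * ((‖K i x‖ ^ 2 + ‖K i y‖ ^ 2) / 2) := by
        refine Finset.sum_le_sum fun i _ => (re_inner_le_norm _ _).trans ?_
        calc ‖X (K i x)‖ * ‖K i y‖ ≤ ‖X‖ * ‖K i x‖ * ‖K i y‖ := by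
              gcongr; exact X.le_opNorm _
          _ ≤ _ := by
              rw [mul_assoc]
              gcongr
              nlinarith [sq_nonneg (‖K i x‖ - ‖K i y‖)]
    _ = ‖X‖ * ((∑ i, ‖K i x‖ ^ 2 + ∑ i, ‖K i y‖ ^ 2) / 2) := by
        rw [← Finset.mul_sum, ← Finset.sum_div, Finset.sum_add_distrib]
    _ ≤ ‖X‖ * ((c + c) / 2) := by gcongr <;> [exact hsq x hx; exact hsq y hy]
    _ = c * ‖X‖ := by ring

theorem norm_sum_conjTranspose_mul_mul_le {n ι : Type*} [Fintype n] [DecidableEq n] [Fintype ι]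
    (K : ι → Matrix n n ℂ) (X : Matrix n n ℂ) :
    ‖∑ i, (K i).conjTranspose * X * K i‖ ≤ ‖∑ i, (K i).conjTranspose * K i‖ * ‖X‖ := by
  have := norm_sum_adjoint_mul_mul_le (fun i => Matrix.toEuclideanCLM (n := n) (𝕜 := ℂ) (K i))
    (Matrix.toEuclideanCLM (n := n) (𝕜 := ℂ) X)
  simp only [← map_star, ← map_mul, ← map_sum] at this
  exact this

end Kraus

/-! ### Hamiltonian and Lindblad generators are dissipative -/

section Superoperators

variable {N q : ℕ}

@[simp] theorem mulLeft_apply (A X : Op N q) : mulLeft A X = A * X := rfl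

@[simp] theorem mulRight_apply (A X : Op N q) : mulRight A X = X * A := rfl

theorem norm_one_superOp_le : ‖(1 : SuperOp N q)‖ ≤ 1 := ContinuousLinearMap.norm_id_le

theorem norm_one_op_le : ‖(1 : Op N q)‖ ≤ 1 := by
  rw [Matrix.cstar_norm_def, map_one]
  exact ContinuousLinearMap.norm_id_le

theorem one_add_real_smul_apply (h : ℝ) (A : SuperOp N q) (X : Op N q) :
    (1 + h • A) X = X + (h : ℂ) • A X := rfl

theorem hamiltonianPart_apply (H X : Op N q) :
    hamiltonianPart H X = Complex.I • (H * X - X * H) := rfl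

theorem dissipative_hamiltonianPart {H : Op N q} (hH : H.IsHermitian) :
    Dissipative (hamiltonianPart H) := by
  refine Dissipative.of_sq_bound (2 * ‖H‖ ^ 2) fun h _ => ?_
  refine ContinuousLinearMap.opNorm_le_bound _ (by positivity) fun X => ?_
  -- First-order approximation of the unitary `exp (-i h H)`: conjugation by it is the Euler step up
  -- to `h ^ 2` terms.
  set U : Op N q := 1 - (Complex.I * h) • H with hU
  have hU' : U.conjTranspose = 1 + (Complex.I * h) • H := by
    simp [hU, Matrix.conjTranspose_sub, Matrix.conjTranspose_smul, hH.eq]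
  have hUU : U.conjTranspose * U = 1 + ((h : ℂ) ^ 2) • (H * H) := by
    rw [hU', hU]
    simp only [mul_sub, add_mul, one_mul, mul_one, smul_mul_assoc, mul_smul_comm, smul_add, smul_smul]
    have : Complex.I * h * (Complex.I * h) = -(h : ℂ) ^ 2 := by
      linear_combination (h : ℂ) ^ 2 * Complex.I_sq
    rw [this]
    module
  have hnorm : ‖U.conjTranspose * U‖ ≤ 1 + h ^ 2 * ‖H‖ ^ 2 := by
    rw [hUU]
    refine (norm_add_le _ _).trans (add_le_add norm_one_op_le ?_)
    rw [norm_smul, norm_pow, Complex.norm_real, Real.norm_eq_abs, sq_abs]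
    gcongr
    exact (norm_mul_le H H).trans_eq (sq _).symm
  have e : (1 + h • hamiltonianPart H) X
      = U.conjTranspose * X * U - ((h : ℂ) ^ 2) • (H * X * H) := by
    rw [one_add_real_smul_apply, hamiltonianPart_apply, hU', hU]
    simp only [mul_sub, add_mul, one_mul, mul_one, smul_mul_assoc, mul_smul_comm, smul_add,
      smul_sub, smul_smul]
    have : Complex.I * h * (Complex.I * h) = -(h : ℂ) ^ 2 := by
      linear_combination (h : ℂ) ^ 2 * Complex.I_sq
    rw [this]
    module
  have hk := norm_sum_conjTranspose_mul_mul_le (fun _ : Unit => U) X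
  simp only [Finset.univ_unique, Finset.sum_singleton] at hk
  rw [e]
  calc ‖U.conjTranspose * X * U - ((h : ℂ) ^ 2) • (H * X * H)‖
      ≤ ‖U.conjTranspose * X * U‖ + ‖((h : ℂ) ^ 2) • (H * X * H)‖ := norm_sub_le _ _
    _ ≤ (1 + h ^ 2 * ‖H‖ ^ 2) * ‖X‖ + h ^ 2 * (‖H‖ * ‖X‖ * ‖H‖) := by
        gcongr
        · exact hk.trans (by gcongr)
        · rw [norm_smul, norm_pow, Complex.norm_real, Real.norm_eq_abs, sq_abs]
          gcongr
          exact (norm_mul_le _ _).trans (by gcongr; exact norm_mul_le _ _)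
    _ = (1 + h ^ 2 * (2 * ‖H‖ ^ 2)) * ‖X‖ := by ring

theorem dissipative_lindblad (L : Op N q) :
    Dissipative ((1 / 2 : ℂ) • ((2 : ℂ) • (mulLeft L.conjTranspose * mulRight L)
      - mulRight (L.conjTranspose * L) - mulLeft (L.conjTranspose * L))) := by
  set G := L.conjTranspose * L with hG
  have hGh : G.conjTranspose = G := by simp [hG]
  refine Dissipative.of_sq_bound (‖G‖ ^ 2 / 2) fun h hh => ?_
  refine ContinuousLinearMap.opNorm_le_bound _ (by positivity) fun X => ?_
  -- Kraus operators of an infinitesimal Lindblad step: no jump, and one jump with amplitude `√h`.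
  -- The first-order terms cancel in `∑ b, (K b).conjTranspose * K b`.
  set K : Bool → Op N q := fun b => bif b then 1 - (h / 2 : ℂ) • G else (√h : ℂ) • L with hK
  have hs : (√h : ℂ) * (√h : ℂ) = h := by
    rw [← Complex.ofReal_mul, Real.mul_self_sqrt hh.le]
  have hK1 : (K true).conjTranspose = 1 - (h / 2 : ℂ) • G := by
    simp [hK, Matrix.conjTranspose_smul, hGh]
  have hK0 : (K false).conjTranspose = (√h : ℂ) • L.conjTranspose := by
    simp [hK, Matrix.conjTranspose_smul]
  have hKK : ∑ b, (K b).conjTranspose * K b = 1 + ((h : ℂ) ^ 2 / 4) • (G * G) := by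
    rw [Fintype.sum_bool, hK1, hK0]
    simp only [hK, cond_true, cond_false, mul_sub, sub_mul, one_mul, mul_one, smul_mul_assoc,
      mul_smul_comm, smul_smul, hs, ← hG]
    module
  have h4 : ‖(h : ℂ) ^ 2 / 4‖ = h ^ 2 / 4 := by
    rw [norm_div, norm_pow, Complex.norm_real, Real.norm_eq_abs, sq_abs]; norm_num
  have hnorm : ‖∑ b, (K b).conjTranspose * K b‖ ≤ 1 + h ^ 2 / 4 * ‖G‖ ^ 2 := by
    rw [hKK]
    refine (norm_add_le _ _).trans (add_le_add norm_one_op_le ?_)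
    rw [norm_smul, h4]
    gcongr
    exact (norm_mul_le G G).trans_eq (sq _).symm
  have e : (1 + h • ((1 / 2 : ℂ) • ((2 : ℂ) • (mulLeft L.conjTranspose * mulRight L)
      - mulRight G - mulLeft G))) X
      = ∑ b, (K b).conjTranspose * X * K b - ((h : ℂ) ^ 2 / 4) • (G * X * G) := by
    have : ((1 / 2 : ℂ) • ((2 : ℂ) • (mulLeft L.conjTranspose * mulRight L)
      - mulRight G - mulLeft G)) X
      = (1 / 2 : ℂ) • ((2 : ℂ) • (L.conjTranspose * (X * L)) - X * G - G * X) := rfl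
    rw [one_add_real_smul_apply, this, Fintype.sum_bool, hK1, hK0]
    simp only [hK, cond_true, cond_false, mul_sub, sub_mul, one_mul, mul_one, smul_mul_assoc,
      mul_smul_comm, smul_smul, hs, smul_sub, mul_assoc]
    module
  rw [e]
  calc ‖∑ b, (K b).conjTranspose * X * K b - ((h : ℂ) ^ 2 / 4) • (G * X * G)‖
      ≤ ‖∑ b, (K b).conjTranspose * X * K b‖ + ‖((h : ℂ) ^ 2 / 4) • (G * X * G)‖ :=
        norm_sub_le _ _
    _ ≤ (1 + h ^ 2 / 4 * ‖G‖ ^ 2) * ‖X‖ + h ^ 2 / 4 * (‖G‖ * ‖X‖ * ‖G‖) := by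
        gcongr
        · exact (norm_sum_conjTranspose_mul_mul_le K X).trans (by gcongr)
        · rw [norm_smul, h4]
          gcongr
          exact (norm_mul_le _ _).trans (by gcongr; exact norm_mul_le _ _)
    _ = (1 + h ^ 2 * (‖G‖ ^ 2 / 2)) * ‖X‖ := by ring

theorem IsLocalHamiltonianLiouvillian.dissipative {S : Finset (Fin N)} {T : SuperOp N q}
    (hT : IsLocalHamiltonianLiouvillian S T) : Dissipative T := by
  obtain ⟨H, hH, -, rfl⟩ := hT
  exact dissipative_hamiltonianPart hH

theorem IsSiteDissipator.dissipative {k : Fin N} {T : SuperOp N q} (hT : IsSiteDissipator k T) :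
    Dissipative T := by
  obtain ⟨m, L, -, rfl⟩ := hT
  exact Dissipative.sum _ (fun j _ => dissipative_lindblad (L j)) norm_one_superOp_le

/-! ### Local operators -/

/-- The operator on the chain which acts as `a` on the sites in `S`. -/
def embed (S : Finset (Fin N)) (a : Matrix (S → Fin q) (S → Fin q) ℂ) : Op N q :=
  fun σ τ => if ∀ k, k ∉ S → σ k = τ k then a (fun k => σ k) (fun k => τ k) else 0

theorem supportedOn_iff {S : Finset (Fin N)} {A : Op N q} :
    SupportedOn S A ↔ ∃ a, A = embed S a :=
  ⟨fun ⟨a, h⟩ => ⟨a, by ext σ τ; exact h σ τ⟩, fun ⟨a, h⟩ => ⟨a, fun σ τ => by rw [h]; rfl⟩⟩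

open scoped Kronecker in
theorem embed_eq_kronecker (S : Finset (Fin N)) (a : Matrix (S → Fin q) (S → Fin q) ℂ) :
    embed S a = (a ⊗ₖ (1 : Matrix ({k // k ∉ S} → Fin q) ({k // k ∉ S} → Fin q) ℂ)).submatrix
      (Equiv.piEquivPiSubtypeProd (· ∈ S) fun _ => Fin q)
      (Equiv.piEquivPiSubtypeProd (· ∈ S) fun _ => Fin q) := by
  ext σ τ
  simp only [embed, Matrix.submatrix_apply, Matrix.kroneckerMap_apply, Matrix.one_apply,
    Equiv.piEquivPiSubtypeProd, Equiv.coe_fn_mk, funext_iff, Subtype.forall, mul_ite, mul_one,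
    mul_zero]

theorem embed_mul (S : Finset (Fin N)) (a b : Matrix (S → Fin q) (S → Fin q) ℂ) :
    embed S (a * b) = embed S a * embed S b := by
  simp only [embed_eq_kronecker]
  rw [Matrix.submatrix_mul_equiv, ← Matrix.mul_kronecker_mul, one_mul]

theorem embed_one (S : Finset (Fin N)) :
    embed S (1 : Matrix (S → Fin q) (S → Fin q) ℂ) = 1 := by
  rw [embed_eq_kronecker, Matrix.one_kronecker_one, Matrix.submatrix_one_equiv]

theorem conjTranspose_embed (S : Finset (Fin N)) (a : Matrix (S → Fin q) (S → Fin q) ℂ) :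
    (embed S a).conjTranspose = embed S a.conjTranspose := by
  simp only [embed_eq_kronecker]
  rw [Matrix.conjTranspose_submatrix, Matrix.conjTranspose_kronecker, Matrix.conjTranspose_one]

/-- `embed S` as a linear map. -/
def embedLin (S : Finset (Fin N)) : Matrix (S → Fin q) (S → Fin q) ℂ →ₗ[ℂ] Op N q where
  toFun := embed S
  map_add' a b := by
    ext σ τ
    simp only [embed, Matrix.add_apply]
    split_ifs <;> simp
  map_smul' c a := by
    ext σ τ
    simp only [embed, Matrix.smul_apply, RingHom.id_apply]
    split_ifs <;> simp

theorem SupportedOn.conjTranspose {S : Finset (Fin N)} {A : Op N q} (hA : SupportedOn S A) :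
    SupportedOn S A.conjTranspose := by
  obtain ⟨a, rfl⟩ := supportedOn_iff.mp hA
  exact supportedOn_iff.mpr ⟨_, conjTranspose_embed S a⟩

theorem SupportedOn.mono {S T : Finset (Fin N)} (hST : S ⊆ T) {A : Op N q}
    (hA : SupportedOn S A) : SupportedOn T A := by
  classical
  obtain ⟨a, ha⟩ := hA
  refine ⟨Matrix.of fun α β => if ∀ k : T, (k : Fin N) ∉ S → α k = β k then
    a (fun k => α ⟨k, hST k.2⟩) (fun k => β ⟨k, hST k.2⟩) else 0, fun σ τ => ?_⟩
  rw [ha]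
  simp only [Matrix.of_apply]
  by_cases h : ∀ k, k ∉ S → σ k = τ k
  · rw [if_pos h, if_pos fun k hk => h k fun hS => hk (hST hS), if_pos fun (k : T) hk => h k hk]
  · rw [if_neg h]
    by_cases h' : ∀ k, k ∉ T → σ k = τ k
    · rw [if_pos h', if_neg]
      intro h''
      refine h fun k hk => ?_
      by_cases hT : k ∈ T
      · exact h'' ⟨k, hT⟩ hk
      · exact h' k hT
    · rw [if_neg h']

theorem embed_mul_embed_apply {S T : Finset (Fin N)} (hST : Disjoint S T)
    (a : Matrix (S → Fin q) (S → Fin q) ℂ) (b : Matrix (T → Fin q) (T → Fin q) ℂ)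
    (σ τ : Fin N → Fin q) :
    (embed S a * embed T b) σ τ = if ∀ k, k ∉ S → k ∉ T → σ k = τ k then
      a (fun k => σ k) (fun k => τ k) * b (fun k => σ k) (fun k => τ k) else 0 := by
  classical
  have hS : ∀ k ∈ S, k ∉ T := fun k h h' => Finset.disjoint_left.mp hST h h'
  -- The first factor fixes the intermediate configuration off `S`, the second fixes it off `T`; by
  -- disjointness only one survives.
  rw [Matrix.mul_apply, Finset.sum_eq_single (S.piecewise τ σ)]
  · have e1 : (fun k : S => S.piecewise τ σ (k : Fin N)) = fun k : S => τ k := by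
      ext k; simp
    have e2 : (fun k : T => S.piecewise τ σ (k : Fin N)) = fun k : T => σ k := by
      ext k; rw [Finset.piecewise_eq_of_notMem _ _ _ fun h => hS _ h k.2]
    simp only [embed, e1, e2]
    rw [if_pos fun k hk => (Finset.piecewise_eq_of_notMem _ _ _ hk).symm, mul_ite, mul_zero]
    refine if_congr ⟨fun h k hk hk' => ?_, fun h k hk => ?_⟩ rfl rfl
    · rw [← h k hk', Finset.piecewise_eq_of_notMem _ _ _ hk]
    · by_cases hkS : k ∈ S
      · rw [Finset.piecewise_eq_of_mem _ _ _ hkS]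
      · rw [Finset.piecewise_eq_of_notMem _ _ _ hkS, h k hkS hk]
  · intro ρ _ hρ
    by_contra hne
    refine hρ (funext fun k => ?_)
    have h1 : ∀ k, k ∉ S → σ k = ρ k := by
      by_contra h; exact hne (by simp only [embed]; rw [if_neg h, zero_mul])
    have h2 : ∀ k, k ∉ T → ρ k = τ k := by
      by_contra h; exact hne (by simp only [embed]; rw [if_neg h, mul_zero])
    by_cases hkS : k ∈ S
    · rw [Finset.piecewise_eq_of_mem _ _ _ hkS, h2 k (hS k hkS)]
    · rw [Finset.piecewise_eq_of_notMem _ _ _ hkS, h1 k hkS]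
  · simp

theorem SupportedOn.commute {S T : Finset (Fin N)} (hST : Disjoint S T) {A B : Op N q}
    (hA : SupportedOn S A) (hB : SupportedOn T B) : A * B = B * A := by
  obtain ⟨a, rfl⟩ := supportedOn_iff.mp hA
  obtain ⟨b, rfl⟩ := supportedOn_iff.mp hB
  ext σ τ
  rw [embed_mul_embed_apply hST, embed_mul_embed_apply hST.symm]
  exact if_congr ⟨fun h k h1 h2 => h k h2 h1, fun h k h1 h2 => h k h2 h1⟩ (mul_comm _ _) rfl

/-! ### Averaging over the sites in a set -/

/-- The matrix unit `|α⟩⟨β|` on the sites in `S`. -/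
def matUnit (S : Finset (Fin N)) (α β : S → Fin q) : Op N q := embed S (Matrix.single α β 1)

theorem supportedOn_matUnit (S : Finset (Fin N)) (α β : S → Fin q) :
    SupportedOn S (matUnit S α β) := supportedOn_iff.mpr ⟨_, rfl⟩

theorem matUnit_mul (S : Finset (Fin N)) (α β γ δ : S → Fin q) :
    matUnit S α β * matUnit S γ δ = if β = γ then matUnit S α δ else 0 := by
  rw [matUnit, matUnit, ← embed_mul]
  split_ifs with h
  · subst h
    rw [Matrix.single_mul_single_same, one_mul]; rfl
  · rw [Matrix.single_mul_single_of_ne _ _ _ _ h]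
    exact map_zero (embedLin S)

theorem conjTranspose_matUnit (S : Finset (Fin N)) (α β : S → Fin q) :
    (matUnit S α β).conjTranspose = matUnit S β α := by
  rw [matUnit, conjTranspose_embed, Matrix.conjTranspose_single, star_one]; rfl

theorem embed_eq_sum_matUnit (S : Finset (Fin N)) (a : Matrix (S → Fin q) (S → Fin q) ℂ) :
    embed S a = ∑ α, ∑ β, a α β • matUnit S α β := by
  conv_lhs => rw [Matrix.matrix_eq_sum_single a]
  change embedLin S _ = _
  simp only [map_sum]
  refine Finset.sum_congr rfl fun α _ => Finset.sum_congr rfl fun β _ => ?_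
  change _ = _ • embedLin S _
  rw [← map_smul, Matrix.smul_single, smul_eq_mul, mul_one]

theorem sum_matUnit_self (S : Finset (Fin N)) :
    ∑ α : S → Fin q, matUnit S α α = 1 := by
  rw [← embed_one S, embed_eq_sum_matUnit]
  simp [Matrix.one_apply]

/-- The conditional expectation onto the operators which act trivially on the sites in `S`. -/
noncomputable def siteAverage (S : Finset (Fin N)) : SuperOp N q :=
  (Fintype.card (S → Fin q) : ℂ)⁻¹ •
    ∑ p : (S → Fin q) × (S → Fin q), mulLeft (matUnit S p.2 p.1) * mulRight (matUnit S p.1 p.2)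

theorem siteAverage_apply (S : Finset (Fin N)) (X : Op N q) :
    siteAverage S X = (Fintype.card (S → Fin q) : ℂ)⁻¹ •
      ∑ p : (S → Fin q) × (S → Fin q), matUnit S p.2 p.1 * X * matUnit S p.1 p.2 := by
  simp [siteAverage, mul_assoc]

theorem sum_matUnit_mul_matUnit (S : Finset (Fin N)) :
    ∑ p : (S → Fin q) × (S → Fin q), matUnit S p.2 p.1 * matUnit S p.1 p.2
      = (Fintype.card (S → Fin q) : ℂ) • (1 : Op N q) := by
  simp only [matUnit_mul, if_true]
  rw [Fintype.sum_prod_type]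
  simp only [sum_matUnit_self, Finset.sum_const, Finset.card_univ]
  rw [← Nat.cast_smul_eq_nsmul ℂ]

/-- The average is a Kraus map whose operators are rescaled matrix units, and these resolve a
multiple of the identity. -/
theorem norm_siteAverage_le (S : Finset (Fin N)) : ‖(siteAverage S : SuperOp N q)‖ ≤ 1 := by
  refine ContinuousLinearMap.opNorm_le_bound _ zero_le_one fun X => ?_
  rw [siteAverage_apply, norm_smul, norm_inv, Complex.norm_natCast]
  have h := norm_sum_conjTranspose_mul_mul_le
    (fun p : (S → Fin q) × (S → Fin q) => matUnit S p.1 p.2) X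
  simp only [conjTranspose_matUnit] at h
  rw [sum_matUnit_mul_matUnit, norm_smul, Complex.norm_natCast] at h
  set n : ℝ := (Fintype.card (S → Fin q) : ℝ)
  have hn : 0 ≤ n := Nat.cast_nonneg _
  calc n⁻¹ * _ ≤ n⁻¹ * (n * 1 * ‖X‖) := by
        gcongr
        exact h.trans (by gcongr; exact norm_one_op_le)
    _ = (n⁻¹ * n) * ‖X‖ := by ring
    _ ≤ 1 * ‖X‖ := by gcongr; exact inv_mul_le_one

/-- Both products collapse to the same sum over `α` of `matUnit S γ α * X * matUnit S α δ`. Matrix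
units span the operators on `S`, so the average commutes with all of these. -/
theorem matUnit_mul_siteAverage (S : Finset (Fin N)) (γ δ : S → Fin q) (X : Op N q) :
    matUnit S γ δ * siteAverage S X = siteAverage S X * matUnit S γ δ := by
  rw [siteAverage_apply, mul_smul_comm, smul_mul_assoc, Finset.mul_sum, Finset.sum_mul]
  congr 1
  have h1 : ∀ p : (S → Fin q) × (S → Fin q),
      matUnit S γ δ * (matUnit S p.2 p.1 * X * matUnit S p.1 p.2)
        = if p.2 = δ then matUnit S γ p.1 * X * matUnit S p.1 p.2 else 0 := fun p => by
    rw [← mul_assoc, ← mul_assoc, matUnit_mul]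
    by_cases h : δ = p.2
    · simp [h]
    · simp [h, Ne.symm h]
  have h2 : ∀ p : (S → Fin q) × (S → Fin q),
      matUnit S p.2 p.1 * X * matUnit S p.1 p.2 * matUnit S γ δ
        = if p.2 = γ then matUnit S p.2 p.1 * X * matUnit S p.1 δ else 0 := fun p => by
    rw [mul_assoc _ (matUnit S p.1 p.2), matUnit_mul, mul_ite, mul_zero]
  simp only [h1, h2, Fintype.sum_prod_type, Finset.sum_ite_eq', Finset.mem_univ, if_true]

theorem SupportedOn.commute_siteAverage {S : Finset (Fin N)} {A : Op N q} (hA : SupportedOn S A)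
    (X : Op N q) : A * siteAverage S X = siteAverage S X * A := by
  obtain ⟨a, rfl⟩ := supportedOn_iff.mp hA
  simp only [embed_eq_sum_matUnit, Finset.sum_mul, Finset.mul_sum, smul_mul_assoc, mul_smul_comm,
    matUnit_mul_siteAverage]

theorem siteAverage_mul_left {S T : Finset (Fin N)} (hST : Disjoint S T) {A : Op N q}
    (hA : SupportedOn T A) (X : Op N q) : siteAverage S (A * X) = A * siteAverage S X := by
  rw [siteAverage_apply, siteAverage_apply, mul_smul_comm, Finset.mul_sum]
  congr 1
  refine Finset.sum_congr rfl fun p _ => ?_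
  rw [← mul_assoc, (supportedOn_matUnit S p.2 p.1).commute hST hA]
  simp only [mul_assoc]

theorem siteAverage_mul_right {S T : Finset (Fin N)} (hST : Disjoint S T) {A : Op N q}
    (hA : SupportedOn T A) (X : Op N q) : siteAverage S (X * A) = siteAverage S X * A := by
  rw [siteAverage_apply, siteAverage_apply, smul_mul_assoc, Finset.sum_mul]
  congr 1
  refine Finset.sum_congr rfl fun p _ => ?_
  simp only [mul_assoc]
  rw [(supportedOn_matUnit S p.1 p.2).commute hST hA]

theorem siteAverage_eq_self [NeZero q] {S T : Finset (Fin N)} (hST : Disjoint S T) {A : Op N q}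
    (hA : SupportedOn T A) : siteAverage S A = A := by
  have h := siteAverage_mul_left hST hA 1
  have h1 : siteAverage S (1 : Op N q) = 1 := by
    simp only [siteAverage_apply, mul_one, sum_matUnit_mul_matUnit, smul_smul]
    rw [inv_mul_cancel₀ (by simp [NeZero.ne q]), one_smul]
  rwa [h1, mul_one] at h

theorem IsLocalHamiltonianLiouvillian.siteAverage_eq_zero {S : Finset (Fin N)} {T : SuperOp N q}
    (hT : IsLocalHamiltonianLiouvillian S T) (X : Op N q) : T (siteAverage S X) = 0 := by
  obtain ⟨H, -, hS, rfl⟩ := hT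
  rw [hamiltonianPart_apply, hS.commute_siteAverage, sub_self, smul_zero]

theorem IsLocalHamiltonianLiouvillian.siteAverage_comm {S S' : Finset (Fin N)}
    (hS : Disjoint S' S) {T : SuperOp N q} (hT : IsLocalHamiltonianLiouvillian S T) (X : Op N q) :
    siteAverage S' (T X) = T (siteAverage S' X) := by
  obtain ⟨H, -, hH, rfl⟩ := hT
  rw [hamiltonianPart_apply, hamiltonianPart_apply, map_smul, map_sub,
    siteAverage_mul_left hS hH, siteAverage_mul_right hS hH]

/-- The average commutes with each Lindblad operator and its adjoint, so the three terms of the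
dissipator cancel. -/
theorem IsSiteDissipator.siteAverage_eq_zero {k : Fin N} {S : Finset (Fin N)} (hk : k ∈ S)
    {T : SuperOp N q} (hT : IsSiteDissipator k T) (X : Op N q) : T (siteAverage S X) = 0 := by
  obtain ⟨m, L, hL, rfl⟩ := hT
  rw [dissipator, sum_apply]
  refine Finset.sum_eq_zero fun j _ => ?_
  have h1 := ((hL j).mono (Finset.singleton_subset_iff.mpr hk)).commute_siteAverage X
  have h2 := ((hL j).mono (Finset.singleton_subset_iff.mpr hk)).conjTranspose.commute_siteAverage X
  set Y := siteAverage S X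
  set A := (L j).conjTranspose
  change (1 / 2 : ℂ) • ((2 : ℂ) • (A * (Y * L j)) - Y * (A * L j) - A * L j * Y) = 0
  rw [← mul_assoc Y, ← h2, mul_assoc A (L j), h1, mul_assoc, two_smul]
  abel_nf
  simp

end Superoperators

/-! ### Sums over the chain -/

section Chain

variable {N : ℕ}

/-- The distance of two sites. -/
def siteDist (i j : Fin N) : ℕ := ((i : ℤ) - j).natAbs

theorem siteDist_le_of_not_disjoint {R : ℕ} {i j : Fin N}
    (h : ¬ Disjoint (nbhd R i) (nbhd R j)) : siteDist i j ≤ 2 * R := by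
  obtain ⟨k, hi, hj⟩ := Finset.not_disjoint_iff.mp h
  simp only [nbhd, Finset.mem_filter, Finset.mem_univ, true_and] at hi hj
  unfold siteDist
  omega

theorem mem_nbhd_self (R : ℕ) (i : Fin N) : i ∈ nbhd R i := by simp [nbhd]

theorem siteDist_le_of_mem_nbhd {R : ℕ} {i b : Fin N} (h : b ∈ nbhd R i) : siteDist i b ≤ R := by
  simp only [nbhd, Finset.mem_filter, Finset.mem_univ, true_and] at h
  unfold siteDist
  omega

theorem siteDist_triangle (i j k : Fin N) : siteDist i k ≤ siteDist i j + siteDist j k := by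
  unfold siteDist; omega

theorem card_siteDist_le (j : Fin N) (m : ℕ) :
    (Finset.univ.filter fun i => siteDist i j ≤ m).card ≤ 2 * m + 1 := by
  calc (Finset.univ.filter fun i => siteDist i j ≤ m).card
      ≤ (Finset.Icc ((j : ℕ) - m) (j + m)).card := by
        refine Finset.card_le_card_of_injOn (fun i => (i : ℕ)) (fun i hi => ?_)
          (fun i _ j _ h => Fin.ext h)
        replace hi := (Finset.mem_filter.mp (Finset.mem_coe.mp hi)).2
        simp only [siteDist] at hi
        simp only [Finset.coe_Icc, mem_Icc]
        omega
    _ ≤ 2 * m + 1 := by rw [Nat.card_Icc]; omega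

theorem sum_siteDist_le {f : ℕ → ℝ} (hf : ∀ d, 0 ≤ f d) (b : Fin N) :
    ∑ k, f (siteDist k b) ≤ 2 * ∑ d ∈ Finset.range N, f d := by
  have hmaps : ∀ k ∈ (Finset.univ : Finset (Fin N)), siteDist k b ∈ Finset.range N := fun k _ => by
    rw [Finset.mem_range, siteDist]; omega
  rw [← Finset.sum_fiberwise_of_maps_to hmaps, Finset.mul_sum]
  refine Finset.sum_le_sum fun d _ => ?_
  -- On a line at most two sites lie at a given distance from `b`.
  have hcard : (Finset.univ.filter fun k => siteDist k b = d).card ≤ 2 := by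
    refine (Finset.card_le_card_of_injOn (t := {(b : ℕ) - d, b + d}) (fun i : Fin N => (i : ℕ))
      (fun i hi => ?_) (fun i _ j _ h => Fin.ext h)).trans Finset.card_le_two
    replace hi := (Finset.mem_filter.mp (Finset.mem_coe.mp hi)).2
    simp only [siteDist] at hi
    simp only [Finset.coe_insert, Finset.coe_singleton, mem_insert_iff, mem_singleton_iff]
    omega
  calc ∑ k ∈ Finset.univ.filter (fun k => siteDist k b = d), f (siteDist k b)
      = (Finset.univ.filter fun k => siteDist k b = d).card * f d := by
        rw [Finset.sum_congr rfl fun k hk => by rw [(Finset.mem_filter.mp hk).2],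
          Finset.sum_const, nsmul_eq_mul]
    _ ≤ 2 * f d := by
        gcongr
        · exact hf d
        · exact_mod_cast hcard

/-- A profile which is bounded, and which decays exponentially outside of a cone of size `m`,
has a sum which is linear in `m`. -/
theorem sum_le_of_cone {a : Fin N → ℝ} {b : Fin N} {β K : ℝ} (hβ : 0 ≤ β) (hK : 0 ≤ K) (m : ℕ)
    (h1 : ∀ k, a k ≤ 2 * β) (h2 : ∀ k, 2 ^ siteDist k b * a k ≤ K * β * 2 ^ m) :
    ∑ k, a k ≤ β * (4 * m + 4 * K) := by
  set f : ℕ → ℝ := fun d => if d < m then 2 * β else K * β * (1 / 2) ^ (d - m) with hf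
  have hf0 : ∀ d, 0 ≤ f d := fun d => by
    simp only [hf]; split_ifs <;> positivity
  have hle : ∀ k, a k ≤ f (siteDist k b) := fun k => by
    simp only [hf]
    split_ifs with h
    · exact h1 k
    · obtain ⟨e, he⟩ := Nat.exists_eq_add_of_le (not_lt.mp h)
      have h3 := h2 k
      rw [he, pow_add] at h3
      rw [he, Nat.add_sub_cancel_left, one_div, inv_pow, ← div_eq_mul_inv,
        le_div_iff₀ (by positivity)]
      refine le_of_mul_le_mul_left ?_ (by positivity : (0 : ℝ) < 2 ^ m)
      linarith
  calc ∑ k, a k ≤ ∑ k, f (siteDist k b) := Finset.sum_le_sum fun k _ => hle k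
    _ ≤ 2 * ∑ d ∈ Finset.range N, f d := sum_siteDist_le hf0 b
    -- Lengthening the range allows a split at `m` without comparing `m` to `N`.
    _ ≤ 2 * ∑ d ∈ Finset.range (m + N), f d := by
        refine mul_le_mul_of_nonneg_left ?_ two_pos.le
        refine Finset.sum_le_sum_of_subset_of_nonneg ?_ fun d _ _ => hf0 d
        exact Finset.range_subset_range.mpr (by omega)
    _ = 2 * (m * (2 * β) + K * β * ∑ j ∈ Finset.range N, (1 / 2 : ℝ) ^ j) := by
        rw [Finset.sum_range_add, Finset.mul_sum]
        congr 2
        · rw [Finset.sum_congr rfl fun d hd => if_pos (Finset.mem_range.mp hd), Finset.sum_const,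
            Finset.card_range, nsmul_eq_mul]
        · refine Finset.sum_congr rfl fun j _ => ?_
          simp [hf]
    _ ≤ 2 * (m * (2 * β) + K * β * 2) := by gcongr; exact sum_geometric_two_le N
    _ = β * (4 * m + 4 * K) := by ring

end Chain

/-! ### Lieb-Robinson bound -/

section LiebRobinson

variable {N q : ℕ}

/-- A dissipative drift does not increase the norm to first order; only the source `r` contributes.
-/
theorem diniLE_norm_of_dissipative {z : ℝ → Op N q} {A : SuperOp N q} {r : Op N q} {x : ℝ}
    (hA : Dissipative A) (hz : HasDerivAt z (A (z x) + r) x) :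
    DiniLE (fun u => ‖z u‖) x ‖r‖ := by
  refine diniLE_norm_of_hasDerivAt hz fun ε hε => ?_
  filter_upwards [hA (ε / (‖z x‖ + 1)) (by positivity), self_mem_nhdsWithin] with h hh hh0
  have hpos : 0 < h := hh0
  have e : z x + h • (A (z x) + r) = (1 + h • A) (z x) + h • r := by
    rw [smul_add, ← add_assoc]; rfl
  have hle : ε / (‖z x‖ + 1) * ‖z x‖ ≤ ε := by
    rw [div_mul_eq_mul_div, div_le_iff₀ (by positivity)]
    nlinarith [norm_nonneg (z x)]
  calc ‖z x + h • (A (z x) + r)‖ ≤ ‖(1 + h • A) (z x)‖ + ‖h • r‖ := by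
        rw [e]; exact norm_add_le _ _
    _ ≤ (1 + h * (ε / (‖z x‖ + 1))) * ‖z x‖ + h * ‖r‖ := by
        rw [norm_smul, Real.norm_of_nonneg hpos.le]
        gcongr
        exact ContinuousLinearMap.le_of_opNorm_le _ hh _
    _ = ‖z x‖ + h * (ε / (‖z x‖ + 1) * ‖z x‖ + ‖r‖) := by ring
    _ ≤ ‖z x‖ + h * (‖r‖ + ε) := by
        rw [add_comm (‖r‖)]
        gcongr

/-- The part of `X` which acts nontrivially on the sites in `S`. -/
noncomputable def fluctuation (S : Finset (Fin N)) : SuperOp N q := 1 - siteAverage S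

theorem fluctuation_apply (S : Finset (Fin N)) (X : Op N q) :
    fluctuation S X = X - siteAverage S X := rfl

theorem norm_fluctuation_apply_le (S : Finset (Fin N)) (X : Op N q) :
    ‖fluctuation S X‖ ≤ 2 * ‖X‖ := by
  have := ContinuousLinearMap.le_of_opNorm_le _ (norm_siteAverage_le S) X
  rw [fluctuation_apply]
  linarith [norm_sub_le X (siteAverage S X)]

theorem norm_apply_le_of_siteAverage_eq_zero {S : Finset (Fin N)} {T : SuperOp N q} {J : ℝ}
    (hT : ‖T‖ ≤ J) (X : Op N q) (h : T (siteAverage S X) = 0) :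
    ‖T X‖ ≤ J * ‖fluctuation S X‖ := by
  have : T X = T (fluctuation S X) := by rw [fluctuation_apply, map_sub, h, sub_zero]
  rw [this]
  exact ContinuousLinearMap.le_of_opNorm_le _ hT _

variable {R : ℕ} {J : ℝ} {L : Fin N → ℝ → SuperOp N q} {y : ℝ → Op N q}

theorem norm_le_norm_zero_of_hasDerivAt
    (hL : ∀ i u, IsLocalHamiltonianLiouvillian (nbhd R i) (L i u))
    (hy : ∀ u, HasDerivAt y ((∑ i, L i u) (y u)) u) {u : ℝ} (hu : 0 ≤ u) : ‖y u‖ ≤ ‖y 0‖ := by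
  have hc : Continuous y := continuous_iff_continuousAt.mpr fun u => (hy u).continuousAt
  refine DiniLE.le_of_nonpos (f := fun u => ‖y u‖) (T := u) hc.norm.continuousOn
    (fun x _ => ?_) u ⟨hu, le_rfl⟩
  have h := diniLE_norm_of_dissipative (z := y) (r := 0) (x := x)
    (Dissipative.sum Finset.univ (fun i _ => (hL i x).dissipative) norm_one_superOp_le)
    (by rw [add_zero]; exact hy x)
  rwa [norm_zero] at h

/-- Terms with support disjoint from `nbhd R i` commute with the fluctuation map and form a
dissipative drift. Each remaining term annihilates the average over its own support `nbhd R j`, so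
it is controlled by the fluctuation there. Averaging over whole neighbourhoods, not single sites, is
what closes the system. -/
theorem diniLE_norm_fluctuation (hL : ∀ i u, IsLocalHamiltonianLiouvillian (nbhd R i) (L i u))
    (hJ : ∀ i u, ‖L i u‖ ≤ J) (hy : ∀ u, HasDerivAt y ((∑ i, L i u) (y u)) u)
    (i : Fin N) (u : ℝ) :
    DiniLE (fun u => ‖fluctuation (nbhd R i) (y u)‖) u
      (∑ j with siteDist i j ≤ 2 * R, 2 * J * ‖fluctuation (nbhd R j) (y u)‖) := by
  set P : SuperOp N q := fluctuation (nbhd R i) with hP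
  have hder : HasDerivAt (fun u => P (y u)) (P ((∑ j, L j u) (y u))) u :=
    (P.restrictScalars ℝ).hasFDerivAt.comp_hasDerivAt u (hy u)
  have hfar : ∀ j, ¬ siteDist i j ≤ 2 * R → P (L j u (y u)) = L j u (P (y u)) := fun j hj => by
    have hd : Disjoint (nbhd R i) (nbhd R j) := by
      by_contra h; exact hj (siteDist_le_of_not_disjoint h)
    rw [hP, fluctuation_apply, fluctuation_apply, map_sub, (hL j u).siteAverage_comm hd]
  have e : P ((∑ j, L j u) (y u)) = (∑ j with ¬ siteDist i j ≤ 2 * R, L j u) (P (y u))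
      + ∑ j with siteDist i j ≤ 2 * R, P (L j u (y u)) := by
    rw [sum_apply, sum_apply, map_sum, ← Finset.sum_filter_not_add_sum_filter Finset.univ
      (fun j => siteDist i j ≤ 2 * R)]
    congr 1
    exact Finset.sum_congr rfl fun j hj => hfar j (Finset.mem_filter.mp hj).2
  rw [e] at hder
  refine (diniLE_norm_of_dissipative (Dissipative.sum _ (fun j _ => (hL j u).dissipative)
    norm_one_superOp_le) hder).mono ((norm_sum_le _ _).trans (Finset.sum_le_sum fun j _ => ?_))
  have := norm_apply_le_of_siteAverage_eq_zero (hJ j u) (y u) ((hL j u).siteAverage_eq_zero (y u))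
  linarith [norm_fluctuation_apply_le (nbhd R i) (L j u (y u))]

/-- Grönwall for the weighted sum. In the rate, `4 ^ R` is the change of weight across distance `2 *
R`, and `4 * R + 1` bounds the number of sites coupled to a given one. -/
theorem weighted_fluctuation_le (hJ0 : 0 ≤ J)
    (hL : ∀ i u, IsLocalHamiltonianLiouvillian (nbhd R i) (L i u))
    (hJ : ∀ i u, ‖L i u‖ ≤ J) (hy : ∀ u, HasDerivAt y ((∑ i, L i u) (y u)) u) (b : Fin N)
    {u : ℝ} (hu : 0 ≤ u) :
    ∑ i, 2 ^ siteDist i b * ‖fluctuation (nbhd R i) (y u)‖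
      ≤ (∑ i, 2 ^ siteDist i b * ‖fluctuation (nbhd R i) (y 0)‖)
        * Real.exp (2 * J * (4 * R + 1) * 4 ^ R * u) := by
  have hc : Continuous y := continuous_iff_continuousAt.mpr fun u => (hy u).continuousAt
  refine DiniLE.le_exp (f := fun u => ∑ i, 2 ^ siteDist i b * ‖fluctuation (nbhd R i) (y u)‖)
    (T := u) ?_ (fun x _ => ?_) u ⟨hu, le_rfl⟩
  · refine Continuous.continuousOn (continuous_finsetSum _ fun i _ => continuous_const.mul ?_)
    exact ((fluctuation (nbhd R i)).continuous.comp hc).norm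
  set g : Fin N → ℝ := fun j => ‖fluctuation (nbhd R j) (y x)‖ with hg
  have hg0 : ∀ j, 0 ≤ g j := fun j => norm_nonneg _
  refine (DiniLE.sum Finset.univ fun i _ => (diniLE_norm_fluctuation hL hJ hy i x).const_mul
    (by positivity : (0 : ℝ) < 2 ^ siteDist i b)).mono ?_
  change ∑ i, 2 ^ siteDist i b * ∑ j with siteDist i j ≤ 2 * R, 2 * J * g j ≤ _
  calc ∑ i, 2 ^ siteDist i b * ∑ j with siteDist i j ≤ 2 * R, 2 * J * g j
      ≤ ∑ i, ∑ j with siteDist i j ≤ 2 * R, 2 * J * 4 ^ R * (2 ^ siteDist j b * g j) := by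
        refine Finset.sum_le_sum fun i _ => ?_
        rw [Finset.mul_sum]
        refine Finset.sum_le_sum fun j hj => ?_
        have hd : siteDist i b ≤ 2 * R + siteDist j b :=
          (siteDist_triangle i j b).trans (by have := (Finset.mem_filter.mp hj).2; omega)
        have hp : (2 : ℝ) ^ siteDist i b ≤ 4 ^ R * 2 ^ siteDist j b := by
          calc (2 : ℝ) ^ siteDist i b ≤ 2 ^ (2 * R + siteDist j b) :=
                pow_le_pow_right₀ one_le_two hd
            _ = 4 ^ R * 2 ^ siteDist j b := by rw [pow_add, pow_mul]; norm_num
        calc 2 ^ siteDist i b * (2 * J * g j)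
            ≤ 4 ^ R * 2 ^ siteDist j b * (2 * J * g j) := by
              have := hg0 j
              gcongr
          _ = _ := by ring
    _ = ∑ j, (Finset.univ.filter fun i => siteDist i j ≤ 2 * R).card
          * (2 * J * 4 ^ R * (2 ^ siteDist j b * g j)) := by
        simp only [Finset.sum_filter]
        rw [Finset.sum_comm]
        refine Finset.sum_congr rfl fun j _ => ?_
        rw [← Finset.sum_filter, Finset.sum_const, nsmul_eq_mul]
    _ ≤ ∑ j, (4 * R + 1) * (2 * J * 4 ^ R * (2 ^ siteDist j b * g j)) := by
        refine Finset.sum_le_sum fun j _ => ?_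
        have h := card_siteDist_le j (2 * R)
        have h' : ((Finset.univ.filter fun i => siteDist i j ≤ 2 * R).card : ℝ) ≤ 4 * R + 1 := by
          have : (Finset.univ.filter fun i => siteDist i j ≤ 2 * R).card ≤ 4 * R + 1 := by omega
          exact_mod_cast this
        have := hg0 j
        gcongr
    _ = 2 * J * (4 * R + 1) * 4 ^ R * ∑ i, 2 ^ siteDist i b * g i := by
        rw [Finset.mul_sum]
        exact Finset.sum_congr rfl fun j _ => by ring

theorem weighted_fluctuation_initial_le [NeZero q] {b : Fin N} {B : Op N q}
    (hB : SupportedOn {b} B) :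
    ∑ i, 2 ^ siteDist i b * ‖fluctuation (nbhd R i) B‖ ≤ (2 * R + 1) * 2 ^ R * 2 * ‖B‖ := by
  have hzero : ∀ i, ¬ siteDist i b ≤ R → fluctuation (nbhd R i) B = 0 := fun i hi => by
    rw [fluctuation_apply, siteAverage_eq_self ?_ hB, sub_self]
    rw [Finset.disjoint_singleton_right]
    exact fun h => hi (siteDist_le_of_mem_nbhd h)
  calc ∑ i, 2 ^ siteDist i b * ‖fluctuation (nbhd R i) B‖
      = ∑ i with siteDist i b ≤ R, 2 ^ siteDist i b * ‖fluctuation (nbhd R i) B‖ := by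
        rw [Finset.sum_filter]
        refine Finset.sum_congr rfl fun i _ => ?_
        split_ifs with h
        · rfl
        · rw [hzero i h, norm_zero, mul_zero]
    _ ≤ ∑ i with siteDist i b ≤ R, 2 ^ R * (2 * ‖B‖) := by
        refine Finset.sum_le_sum fun i hi => ?_
        gcongr
        · exact one_le_two
        · exact (Finset.mem_filter.mp hi).2
        · exact norm_fluctuation_apply_le _ _
    _ = (Finset.univ.filter fun i => siteDist i b ≤ R).card * (2 ^ R * (2 * ‖B‖)) := by
        rw [Finset.sum_const, nsmul_eq_mul]
    _ ≤ (2 * R + 1) * (2 ^ R * (2 * ‖B‖)) := by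
        gcongr
        exact_mod_cast card_siteDist_le b R
    _ = _ := by ring

/-- The Lieb-Robinson bound: the total amount by which an evolved single-site observable acts on
the sites of the chain grows at most linearly in time. -/
theorem sum_norm_fluctuation_le [NeZero q] (hJ0 : 0 ≤ J)
    (hL : ∀ i u, IsLocalHamiltonianLiouvillian (nbhd R i) (L i u))
    (hJ : ∀ i u, ‖L i u‖ ≤ J) (hy : ∀ u, HasDerivAt y ((∑ i, L i u) (y u)) u) {b : Fin N}
    (hB : SupportedOn {b} (y 0)) {u : ℝ} (hu : 0 ≤ u) :
    ∑ i, ‖fluctuation (nbhd R i) (y u)‖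
      ≤ ‖y 0‖ * (16 * J * (4 * R + 1) * 4 ^ R * u + (4 + 8 * (2 * R + 1) * 2 ^ R)) := by
  set v : ℝ := 2 * J * (4 * R + 1) * 4 ^ R with hv
  have hv0 : 0 ≤ v := by positivity
  -- The cone radius: as `log 2 > 1 / 2`, the weight `2 ^ m` absorbs the growth `exp (v * u)`.
  set m := ⌈2 * (v * u)⌉₊ with hm
  have hm1 : 2 * (v * u) ≤ m := Nat.le_ceil _
  have hm2 : (m : ℝ) ≤ 2 * (v * u) + 1 := (Nat.ceil_lt_add_one (by positivity)).le
  have hexp : Real.exp (v * u) ≤ 2 ^ m := by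
    have h2 : (2 : ℝ) ^ m = Real.exp (m * Real.log 2) := by
      rw [Real.exp_nat_mul, Real.exp_log two_pos]
    rw [h2, Real.exp_le_exp]
    nlinarith [Real.log_two_gt_d9]
  have key := sum_le_of_cone (a := fun i => ‖fluctuation (nbhd R i) (y u)‖) (b := b)
    (norm_nonneg (y 0)) (K := (2 * R + 1) * 2 ^ R * 2) (by positivity) m
    (fun k => (norm_fluctuation_apply_le _ _).trans
      (by gcongr; exact norm_le_norm_zero_of_hasDerivAt hL hy hu))
    (fun k => by
      calc 2 ^ siteDist k b * ‖fluctuation (nbhd R k) (y u)‖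
          ≤ ∑ i, 2 ^ siteDist i b * ‖fluctuation (nbhd R i) (y u)‖ :=
            Finset.single_le_sum
              (f := fun i => 2 ^ siteDist i b * ‖fluctuation (nbhd R i) (y u)‖)
              (fun i _ => by positivity) (Finset.mem_univ k)
        _ ≤ _ := weighted_fluctuation_le hJ0 hL hJ hy b hu
        _ ≤ _ := by
            gcongr
            exact weighted_fluctuation_initial_le hB)
  refine key.trans (mul_le_mul_of_nonneg_left ?_ (norm_nonneg _))
  rw [hv] at hm2
  linarith

end LiebRobinson

/-! ### Comparison of the propagators -/

section Comparison

variable {N q : ℕ}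

theorem norm_timeOrderedExp_sub_le [NeZero q] {R : ℕ} {J : ℝ} {LH LD : Fin N → ℝ → SuperOp N q}
    {Γ : ℝ} {b : Fin N} {B : Op N q} (hLHc : ∀ i, Continuous (LH i))
    (hLH : ∀ i τ, IsLocalHamiltonianLiouvillian (nbhd R i) (LH i τ))
    (hJ : ∀ i τ, ‖LH i τ‖ ≤ J) (hLDc : ∀ k, Continuous (LD k))
    (hLD : ∀ k τ, IsSiteDissipator k (LD k τ)) (hLD1 : ∀ k τ, ‖LD k τ‖ ≤ 1) (hΓ : 0 ≤ Γ)
    (hB : SupportedOn {b} B) {t : ℝ} (ht : 0 ≤ t) :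
    ‖timeOrderedExp (fun τ => (∑ i, LH i τ) + (Γ : ℂ) • (∑ k, LD k τ)) t 0 B
        - timeOrderedExp (fun τ => ∑ i, LH i τ) t 0 B‖
      ≤ Γ * (‖B‖ * (16 * J * (4 * R + 1) * 4 ^ R * t + (4 + 8 * (2 * R + 1) * 2 ^ R))) * t := by
  have hJ0 : 0 ≤ J := (norm_nonneg _).trans (hJ b 0)
  set H : ℝ → SuperOp N q := fun τ => ∑ i, LH i τ with hH
  set D : ℝ → SuperOp N q := fun τ => (Γ : ℂ) • (∑ k, LD k τ) with hD
  have hHc : Continuous H := continuous_finsetSum _ fun i _ => hLHc i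
  have hDc : Continuous D := (continuous_finsetSum _ fun i _ => hLDc i).const_smul (Γ : ℂ)
  have hdiss : ∀ τ, Dissipative (H τ + D τ) := fun τ => by
    refine Dissipative.add (Dissipative.sum _ (fun i _ => (hLH i τ).dissipative)
      norm_one_superOp_le) ?_
    exact Dissipative.smul (Dissipative.sum _ (fun i _ => (hLD i τ).dissipative)
      norm_one_superOp_le) hΓ norm_one_superOp_le
  obtain ⟨W, hW0, hW⟩ := exists_hasDerivAt_neg_mul (𝔸 := SuperOp N q) hHc
  set V : ℝ → SuperOp N q := fun s => timeOrderedExp (fun τ => H τ + D τ) s 0 with hV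
  have hVder : ∀ s, HasDerivAt V (V s * (H s + D s)) s := hasDerivAt_timeOrderedExp (hHc.add hDc)
  have hV1 : ∀ s, 0 ≤ s → ‖V s‖ ≤ 1 := fun s hs =>
    norm_timeOrderedExp_le_one (hHc.add hDc) norm_one_superOp_le hdiss hs
  have hV0 : V 0 = 1 := timeOrderedExp_self _ _
  set U : SuperOp N q := timeOrderedExp H t 0 with hU
  have hUW : U * W t = 1 := timeOrderedExp_mul_eq_one hHc hW0 hW t
  -- In finite dimension a right inverse is also a left inverse.
  have hWU : W t * U = 1 := by
    have h1 : (U : Op N q →ₗ[ℂ] Op N q) * (W t : Op N q →ₗ[ℂ] Op N q) = 1 := by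
      ext1 X; exact congrArg (fun T : SuperOp N q => T X) hUW
    have h2 := mul_eq_one_comm.mp h1
    ext1 X
    exact congrArg (fun T : Op N q →ₗ[ℂ] Op N q => T X) h2
  have heval : ∀ (F : ℝ → SuperOp N q) (F' : SuperOp N q) (s : ℝ) (X : Op N q),
      HasDerivAt F F' s → HasDerivAt (fun s => F s X) (F' X) s := fun F F' s X h =>
    ((ContinuousLinearMap.apply ℂ (Op N q) X).restrictScalars ℝ).hasFDerivAt.comp_hasDerivAt s h
  -- Reversing time turns `W' = -(H * W)` into a forward evolution that starts at `B`, as the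
  -- Lieb-Robinson bound requires.
  set y : ℝ → Op N q := fun u => W (t - u) (U B) with hy
  have hy0 : y 0 = B := by
    simp only [hy, sub_zero]
    exact congrArg (fun T : SuperOp N q => T B) hWU
  have hyder : ∀ u, HasDerivAt y ((∑ i, LH i (t - u)) (y u)) u := fun u => by
    have h := (heval W _ (t - u) (U B) (hW (t - u))).scomp u ((hasDerivAt_id u).const_sub t)
    refine h.congr_deriv ?_
    rw [neg_one_smul]
    change -(-((H (t - u) * W (t - u)) (U B))) = _
    rw [neg_neg]
    rfl
  set M := 16 * J * (4 * R + 1) * 4 ^ R * t + (4 + 8 * (2 * R + 1) * 2 ^ R) with hM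
  have hD_le : ∀ s ∈ Icc 0 t, ‖D s (W s (U B))‖ ≤ Γ * (‖B‖ * M) := fun s hs => by
    have hfl := sum_norm_fluctuation_le (L := fun i u => LH i (t - u)) hJ0
      (fun i u => hLH i (t - u)) (fun i u => hJ i (t - u)) hyder (b := b) (by rwa [hy0])
      (u := t - s) (by linarith [hs.2])
    have hys : y (t - s) = W s (U B) := by simp only [hy, sub_sub_cancel]
    rw [hy0, hys] at hfl
    have e : D s (W s (U B)) = (Γ : ℂ) • ∑ k, LD k s (W s (U B)) := by
      rw [← sum_apply]; rfl
    rw [e, norm_smul, Complex.norm_real, Real.norm_of_nonneg hΓ]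
    gcongr
    calc ‖∑ k, LD k s (W s (U B))‖ ≤ ∑ k, ‖fluctuation (nbhd R k) (W s (U B))‖ :=
          norm_sum_le_of_le _ fun k _ => by
            simpa using norm_apply_le_of_siteAverage_eq_zero (hLD1 k s) (W s (U B))
              ((hLD k s).siteAverage_eq_zero (mem_nbhd_self R k) _)
      _ ≤ _ := hfl
      _ ≤ ‖B‖ * M := by
          rw [hM]
          gcongr
          linarith [hs.1]
  have hFder : ∀ s, HasDerivAt (fun s => (V s * W s) (U B)) (V s (D s (W s (U B)))) s :=
    fun s => heval _ _ s (U B) (hasDerivAt_mul_of_propagators (hVder s) (hW s))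
  have hmv := norm_image_sub_le_of_norm_deriv_le_segment' (a := 0) (b := t)
    (fun s _ => (hFder s).hasDerivWithinAt) (C := Γ * (‖B‖ * M)) (fun s hs => by
      have hs' := Ico_subset_Icc_self hs
      calc ‖V s (D s (W s (U B)))‖ ≤ 1 * ‖D s (W s (U B))‖ :=
            ContinuousLinearMap.le_of_opNorm_le _ (hV1 s hs.1) _
        _ ≤ _ := by rw [one_mul]; exact hD_le s hs') t ⟨ht, le_rfl⟩
  have e1 : (V t * W t) (U B) = V t B := by
    change V t (W t (U B)) = _
    rw [show W t (U B) = B from congrArg (fun T : SuperOp N q => T B) hWU]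
  have e0 : (V 0 * W 0) (U B) = U B := by rw [hV0, hW0]; rfl
  rw [e1, e0, sub_zero] at hmv
  exact hmv

end Comparison

end SpinChain

theorem lemma2 (R : ℕ) (J t₀ : ℝ) (ht₀ : 0 < t₀) :
    ∃ C : ℝ, ∀ (N q : ℕ) (LH LD : Fin N → ℝ → SpinChain.SuperOp N q) (Γ : ℝ)
      (b : Fin N) (B : SpinChain.Op N q),
      (∀ i, Continuous (LH i)) →
      (∀ i τ, SpinChain.IsLocalHamiltonianLiouvillian (SpinChain.nbhd R i) (LH i τ)) →
      (∀ i τ, ‖LH i τ‖ ≤ J) →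
      (∀ k, Continuous (LD k)) →
      (∀ k τ, SpinChain.IsSiteDissipator k (LD k τ)) →
      (∀ k τ, ‖LD k τ‖ ≤ 1) →
      0 ≤ Γ →
      SpinChain.SupportedOn {b} B →
      ∀ t : ℝ, t₀ ≤ t →
        ‖SpinChain.timeOrderedExp (fun τ => (∑ i, LH i τ) + (Γ : ℂ) • (∑ k, LD k τ)) t 0 B
          - SpinChain.timeOrderedExp (fun τ => ∑ i, LH i τ) t 0 B‖ ≤ Γ * (C * t ^ 2) * ‖B‖ := by
  -- The term linear in `t` is absorbed into `t ^ 2` through `t ≤ t ^ 2 / t₀`.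
  refine ⟨16 * J * (4 * R + 1) * 4 ^ R + (4 + 8 * (2 * R + 1) * 2 ^ R) / t₀, ?_⟩
  intro N q LH LD Γ b B hLHc hLH hJ hLDc hLD hLD1 hΓ hB t ht
  -- For `q = 0` the site average is not unital on `{b}`, but the operator space is zero.
  rcases Nat.eq_zero_or_pos q with rfl | hq
  · have : IsEmpty (Fin N → Fin 0) := ⟨fun f => (f b).elim0⟩
    rw [Subsingleton.elim B 0]
    simp
  have : NeZero q := ⟨hq.ne'⟩
  have ht0 : 0 < t := ht₀.trans_le ht
  refine (SpinChain.norm_timeOrderedExp_sub_le hLHc hLH hJ hLDc hLD hLD1 hΓ hB ht0.le).trans ?_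
  set c : ℝ := 4 + 8 * (2 * R + 1) * 2 ^ R with hc
  have hc0 : 0 ≤ c := by positivity
  have hct : c * t ≤ c / t₀ * t ^ 2 := by
    rw [div_mul_eq_mul_div, le_div_iff₀ ht₀]
    nlinarith [mul_nonneg (mul_nonneg hc0 ht0.le) (sub_nonneg.mpr ht)]
  calc Γ * (‖B‖ * (16 * J * (4 * R + 1) * 4 ^ R * t + c)) * t
      = Γ * (16 * J * (4 * R + 1) * 4 ^ R * t ^ 2 + c * t) * ‖B‖ := by ring
    _ ≤ Γ * (16 * J * (4 * R + 1) * 4 ^ R * t ^ 2 + c / t₀ * t ^ 2) * ‖B‖ := by gcongr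
    _ = _ := by ring
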